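/- Let $\mathbb{R}_{\max}=\mathbb{R}\cup\{-\infty\}$ with $a\oplus b=\max(a,b)$ and tropical multiplication $a\otimes b=a+b$ (where $-\infty$ is absorbing for $\otimes$). Let $n\ge 0$, order $\mathbb{R}_{\max}^n$ componentwise, and for $x,z\in\mathbb{R}_{\max}^n$ write $x^Tz=\max_{1\le i\le n}(x_i+z_i)$ (equal to $-\infty$ if $n=0$). A tropical polyhedron is an intersection of finitely many sets of the form $\{x\in\mathbb{R}_{\max}^n : a^Tx\oplus\alpha\le b^Tx\oplus\beta\}$ with $a,b\in\mathbb{R}_{\max}^n$ and $\alpha,\beta\in\mathbb{R}_{\max}$. A subset $S\subseteq P$ of a tropical polyhedron $P$ is called min-essential if for every $x\in\mathbb{R}_{\max}^n$ the minimum $\min_{z}\{x^Tz : z\in P\}$ exists and is attained at a point of $S$. A point $x\in P$ is called minimal if $y\in P$ and $y\le x$ imply $y=x$. Corollary. Every non-empty tropical polyhedron $P\subseteq\mathbb{R}_{\max}^n$ has a finite min-essential subset; namely, the set of all minimal points of $P$ is finite and is a min-essential subset of $P$. -/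

import Mathlib

/-- The max-plus semiring `ℝ ∪ {-∞}`: tropical addition is `⊔` (with neutral element `⊥ = -∞`),
tropical multiplication is `+` (absorbing at `⊥`, with neutral element `0`). -/
abbrev Rmax : Type := WithBot ℝ

/-- The tropical scalar product `aᵀ x = max_i (a_i + x_i)`; it is `-∞` when `n = 0`. -/
noncomputable def tropDot {n : ℕ} (a x : Fin n → Rmax) : Rmax :=
  Finset.univ.sup fun i => a i + x i

/-- A tropical affine halfspace `{x | aᵀ x ⊕ α ≤ bᵀ x ⊕ β}`. -/
def IsTropHalfspace {n : ℕ} (H : Set (Fin n → Rmax)) : Prop :=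
  ∃ (a b : Fin n → Rmax) (α β : Rmax), H = {x | tropDot a x ⊔ α ≤ tropDot b x ⊔ β}

/-- A tropical polyhedron: an intersection of finitely many tropical affine halfspaces. -/
def IsTropPolyhedron {n : ℕ} (P : Set (Fin n → Rmax)) : Prop :=
  ∃ F : Set (Set (Fin n → Rmax)), F.Finite ∧ (∀ H ∈ F, IsTropHalfspace H) ∧ P = ⋂₀ F

/-- `S` is a min-essential subset of `P`: for every `x`, the minimum of `z ↦ xᵀ z` over `P` exists
and is attained at a point of `S`. -/
def IsMinEssential {n : ℕ} (S P : Set (Fin n → Rmax)) : Prop :=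
  S ⊆ P ∧ ∀ x : Fin n → Rmax, ∃ s ∈ S, IsMinOn (fun z => tropDot x z) P s

/-- The minimal points of `P` for the componentwise order. -/
def minimalPoints {n : ℕ} (P : Set (Fin n → Rmax)) : Set (Fin n → Rmax) :=
  {x | x ∈ P ∧ ∀ y ∈ P, y ≤ x → y = x}

/-! In a halfspace, the maximum on the right is attained by `β` or by one term `b j + x j`. Fixing
which one gives a piece closed under infima: the left side is monotone and the right side involves
at most one coordinate. Distributing intersections over unions, `P` is a finite union of such
pieces. The least elements of the non-empty pieces dominate `P` from below, so they include all
minimal points, and monotonicity of `tropDot x` reduces minimisation to a finite set. -/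

/-- A set is closed under greatest lower bounds of its non-empty subsets. -/
def GLBClosed {α : Type*} [Preorder α] (Q : Set α) : Prop :=
  ∀ S ⊆ Q, S.Nonempty → ∀ m, IsGLB S m → m ∈ Q

/-- A set is a finite union of sets closed under greatest lower bounds. -/
def IsFiniteUnionGLBClosed {α : Type*} [Preorder α] (P : Set α) : Prop :=
  ∃ G : Set (Set α), G.Finite ∧ (∀ Q ∈ G, GLBClosed Q) ∧ P = ⋃₀ G

theorem GLBClosed.inter {α : Type*} [Preorder α] {Q R : Set α} (hQ : GLBClosed Q)
    (hR : GLBClosed R) : GLBClosed (Q ∩ R) := fun S hS hne m hm =>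
  ⟨hQ S (fun _ h => (hS h).1) hne m hm, hR S (fun _ h => (hS h).2) hne m hm⟩

theorem IsFiniteUnionGLBClosed.univ {α : Type*} [Preorder α] :
    IsFiniteUnionGLBClosed (Set.univ : Set α) :=
  ⟨{Set.univ}, Set.finite_singleton _, by simp [GLBClosed], by simp⟩

theorem IsFiniteUnionGLBClosed.inter {α : Type*} [Preorder α] {P R : Set α}
    (hP : IsFiniteUnionGLBClosed P) (hR : IsFiniteUnionGLBClosed R) :
    IsFiniteUnionGLBClosed (P ∩ R) := by
  obtain ⟨G, hG, hGc, rfl⟩ := hP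
  obtain ⟨K, hK, hKc, rfl⟩ := hR
  refine ⟨Set.image2 (· ∩ ·) G K, hG.image2 _ hK, ?_, ?_⟩
  · rintro _ ⟨Q, hQ, R, hR, rfl⟩
    exact (hGc Q hQ).inter (hKc R hR)
  · ext x
    constructor
    · rintro ⟨⟨Q, hQ, hxQ⟩, R, hR, hxR⟩
      exact ⟨Q ∩ R, ⟨Q, hQ, R, hR, rfl⟩, hxQ, hxR⟩
    · rintro ⟨_, ⟨Q, hQ, R, hR, rfl⟩, hxQ, hxR⟩
      exact ⟨⟨Q, hQ, hxQ⟩, R, hR, hxR⟩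

theorem IsFiniteUnionGLBClosed.sInter {α : Type*} [Preorder α] {F : Set (Set α)}
    (hF : F.Finite) (h : ∀ H ∈ F, IsFiniteUnionGLBClosed H) :
    IsFiniteUnionGLBClosed (⋂₀ F) := by
  induction F, hF using Set.Finite.induction_on with
  | empty => simpa using IsFiniteUnionGLBClosed.univ
  | insert _ _ ih =>
    rw [Set.sInter_insert]
    exact (h _ (Set.mem_insert _ _)).inter (ih fun H hH => h H (Set.mem_insert_of_mem _ hH))

theorem tropDot_mono {n : ℕ} (a : Fin n → Rmax) : Monotone (tropDot a) := fun _ _ h =>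
  Finset.sup_mono_fun fun i _ => add_le_add_right (h i) (a i)

/-- Tropical multiplication by a scalar preserves greatest lower bounds of non-empty sets. -/
theorem Rmax.le_add_of_isGLB {S : Set Rmax} {m b c : Rmax} (hS : S.Nonempty) (hm : IsGLB S m)
    (h : ∀ s ∈ S, c ≤ b + s) : c ≤ b + m := by
  induction b using WithBot.recBotCoe with
  -- Non-emptiness matters here: a single `s` forces `c = ⊥`.
  | bot =>
    obtain ⟨s, hs⟩ := hS
    simpa using h s hs
  | coe b =>
    have cancel (r : Rmax) : ((-b : ℝ) : Rmax) + ((b : Rmax) + r) = r := by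
      rw [← add_assoc, ← WithBot.coe_add]; simp
    have cancel' (r : Rmax) : (b : Rmax) + (((-b : ℝ) : Rmax) + r) = r := by
      rw [← add_assoc, ← WithBot.coe_add]; simp
    have hle : ((-b : ℝ) : Rmax) + c ≤ m := hm.2 fun s hs => by
      simpa only [cancel] using add_le_add_right (h s hs) ((-b : ℝ) : Rmax)
    simpa only [cancel'] using add_le_add_right hle (b : Rmax)

theorem IsTropHalfspace.isFiniteUnionGLBClosed {n : ℕ} {H : Set (Fin n → Rmax)}
    (hH : IsTropHalfspace H) : IsFiniteUnionGLBClosed H := by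
  obtain ⟨a, b, α, β, rfl⟩ := hH
  refine ⟨insert {x | tropDot a x ⊔ α ≤ β}
    (Set.range fun j => {x | tropDot a x ⊔ α ≤ b j + x j}), (Set.finite_range _).insert _, ?_, ?_⟩
  · have mono : Monotone fun x => tropDot a x ⊔ α := fun x y h =>
      sup_le_sup_right (tropDot_mono a h) α
    rintro _ (rfl | ⟨j, rfl⟩) S hS hne m hm
    · obtain ⟨s, hs⟩ := hne
      exact (mono (hm.1 hs)).trans (hS hs)
    · refine Rmax.le_add_of_isGLB (hne.image (Function.eval j)) (isGLB_pi.1 hm j) ?_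
      rintro _ ⟨s, hs, rfl⟩
      exact (mono (hm.1 hs)).trans (hS hs)
  · ext x
    rw [Set.mem_ofPred_eq, le_sup_iff]
    constructor
    · rintro (h | h)
      · by_cases hn : (Finset.univ : Finset (Fin n)).Nonempty
        · obtain ⟨j, -, hj⟩ := Finset.exists_mem_eq_sup _ hn fun i => b i + x i
          exact ⟨_, Or.inr ⟨j, rfl⟩, h.trans hj.le⟩
        -- For `n = 0` the right-hand product is `⊥`, so the `β` piece covers this case.
        · rw [Finset.not_nonempty_iff_eq_empty] at hn
          refine ⟨_, Or.inl rfl, h.trans ?_⟩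
          simp [tropDot, hn]
      · exact ⟨_, Or.inl rfl, h⟩
    · rintro ⟨_, rfl | ⟨j, rfl⟩, h⟩
      · exact Or.inr h
      · exact Or.inl (h.trans (Finset.le_sup (f := fun i => b i + x i) (Finset.mem_univ j)))

theorem IsTropPolyhedron.isFiniteUnionGLBClosed {n : ℕ} {P : Set (Fin n → Rmax)}
    (hP : IsTropPolyhedron P) : IsFiniteUnionGLBClosed P := by
  obtain ⟨F, hF, hH, rfl⟩ := hP
  exact .sInter hF fun H h => (hH H h).isFiniteUnionGLBClosed

/-- The coordinatewise infimum exists because `⊥` bounds every coordinate below. -/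
theorem GLBClosed.exists_isLeast {n : ℕ} {Q : Set (Fin n → Rmax)} (hQ : GLBClosed Q)
    (hne : Q.Nonempty) : ∃ m, IsLeast Q m := by
  have h : IsGLB Q fun i => sInf (Function.eval i '' Q) :=
    isGLB_pi.2 fun i => isGLB_csInf (hne.image _) (OrderBot.bddBelow _)
  exact ⟨_, hQ Q subset_rfl hne _ h, h.1⟩

/-- A tropical polyhedron has a finite subset that meets the lower set of each of its points. -/
theorem IsTropPolyhedron.exists_finite_dominating {n : ℕ} {P : Set (Fin n → Rmax)}
    (hP : IsTropPolyhedron P) :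
    ∃ L : Set (Fin n → Rmax), L.Finite ∧ L ⊆ P ∧ ∀ x ∈ P, ∃ m ∈ L, m ≤ x := by
  obtain ⟨G, hG, hGc, rfl⟩ := hP.isFiniteUnionGLBClosed
  refine ⟨⋃ Q ∈ G, {m | IsLeast Q m}, hG.biUnion fun Q _ => ?_, ?_, ?_⟩
  · exact Set.Subsingleton.finite fun _ hx _ hy => hx.unique hy
  · exact Set.iUnion₂_subset fun Q hQ m hm => ⟨Q, hQ, hm.1⟩
  · rintro x ⟨Q, hQ, hx⟩
    obtain ⟨m, hm⟩ := (hGc Q hQ).exists_isLeast ⟨x, hx⟩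
    exact ⟨m, Set.mem_biUnion hQ hm, hm.2 hx⟩

theorem mainTheorem7 {n : ℕ} (P : Set (Fin n → Rmax)) (hP : IsTropPolyhedron P)
    (hne : P.Nonempty) :
    (minimalPoints P).Finite ∧ IsMinEssential (minimalPoints P) P := by
  obtain ⟨L, hL, hLP, hdom⟩ := hP.exists_finite_dominating
  have hfin : (minimalPoints P).Finite := hL.subset fun x hx => by
    obtain ⟨m, hm, hmx⟩ := hdom x hx.1
    exact hx.2 m (hLP hm) hmx ▸ hm
  have hmin : ∀ x ∈ P, ∃ m ∈ minimalPoints P, m ≤ x := fun x hx => by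
    obtain ⟨l, hl, hlx⟩ := hdom x hx
    obtain ⟨m, hml, hm⟩ := hL.exists_le_minimal hl
    refine ⟨m, ⟨hLP hm.1, fun y hy hym => ?_⟩, hml.trans hlx⟩
    -- Minimality in `L` passes to `P`: any `y ≤ m` in `P` lies above some `k ∈ L`, whence `m ≤ k ≤
    -- y`.
    obtain ⟨k, hk, hky⟩ := hdom y hy
    exact le_antisymm hym ((hm.2 hk (hky.trans hym)).trans hky)
  refine ⟨hfin, fun x hx => hx.1, fun x => ?_⟩
  obtain ⟨p, hp⟩ := hne
  obtain ⟨q, hq, -⟩ := hmin p hp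
  obtain ⟨s, hs, hsmin⟩ := Set.exists_min_image _ (tropDot x) hfin ⟨q, hq⟩
  refine ⟨s, hs, fun z hz => ?_⟩
  obtain ⟨m, hm, hmz⟩ := hmin z hz
  exact (hsmin m hm).trans (tropDot_mono x hmz)
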